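/- **Setting.** Let $n\ge 1$ and let $N=\{1,\dots,n\}$ be the set of players. Player $i$ has a compact (not necessarily convex) action set $\mathcal X_i\subset\mathbb R^d$; put $\tilde{\mathcal X}_i=\operatorname{conv}\mathcal X_i$, $\mathcal X=\prod_i\mathcal X_i$, $\tilde{\mathcal X}=\prod_i\tilde{\mathcal X}_i$. In the generalized congestion game $\Gamma$ player $i$ minimizes $$f_i(x)=\Big\langle g\Big(\tfrac1n\sum_j a_jx_j\Big),x_i\Big\rangle+h_i\Big(\tfrac1n\sum_j a_jx_j\Big)+r_i(x_i),\qquad g(y)=(g_1(y_1),\dots,g_d(y_d)).$$ Assume that there are constants $0<m\le M$, $L_g>0$, $L_h\ge0$, $D_1,D_2,B_g,B_r,\Delta$ such that: $m\le a_i\le M$; all coordinates of $\frac1n\sum_j a_jx_j$ lie in $[D_1,D_2]$ for $x\in\tilde{\mathcal X}$; each $g_t:\mathbb R\to\mathbb R$ is $L_g$-Lipschitz and nondecreasing on $[D_1,D_2]$ with $|g_t|\le B_g$ there; each $h_i$ is $L_h$-Lipschitz on $[D_1,D_2]^d$; $|r_i|\le B_r$ on $\mathcal X_i$; and each $\tilde{\mathcal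 X}_i$ has diameter at most $\Delta$ and lies in the closed ball of radius $\Delta$ around $0$ (Euclidean norm). **Equilibria and convexification.** An $\epsilon$-PNE of a game is a profile of feasible actions in which no player can lower her cost by more than $\epsilon$ by a unilateral change of action. The convexification of $\varphi:\mathcal X_i\to\mathbb R$ is the function on $\tilde{\mathcal X}_i$ $$\tilde\varphi(y)=\inf\Big\{\sum_{k=1}^{d+1}\alpha^k\varphi(z^k)\;:\;\alpha^k\ge0,\ \sum_k\alpha^k=1,\ z^k\in\mathcal X_i,\ \sum_k\alpha^kz^k=y\Big\}.$$ Fix $x_i^+\in\mathcal X_i$ for each $i$. The auxiliary game $\bar\Gamma$ has the same action sets and the costs $$\bar f_i(x)=\Big\langle g\Big(\tfrac1n\sum_{j\ne i}a_jx_j+\tfrac1na_ix_i^+\Big),x_i\Big\rangle+r_i(x_i),$$ and $\tilde\Gamma$ is its convexification: action sets $\tilde{\mathcal X}_i$, and cost $\tilde f_i(\cdot,x_{-i})$ equal to the convexification of $\bar f_i(\cdot,x_{-i})$. A generator for $(i,x)$, $x\in\tilde{\mathcal X}$, is a set $Z(i,x)=\{z^1,\dots,z^{d+1}\}\subset\mathcal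 X_i$ (repetitions allowed) for which there are weights $\alpha^k>0$ with $\sum_k\alpha^k=1$, $\sum_k\alpha^kz^k=x_i$ and $\sum_k\alpha^k\bar f_i(z^k,x_{-i})=\tilde f_i(x_i,x_{-i})$. The profile $x$ satisfies the full $\eta$-stability condition if for every generator profile $(Z(i,x))_i$, every $i$ and every $y\in Z(i,x)$ one has $\tilde f_i(y,x_{-i})\le\tilde f_i(x)+\eta$. **Algorithm.** From any $x^0\in\tilde{\mathcal X}$, the gradient-proximal algorithm computes, for $k=1,2,\dots$ and, within each iteration, for $i=1,\dots,n$ in turn, $$x_i^k=\operatorname*{argmin}_{y\in\tilde{\mathcal X}_i}\Big\langle g\Big(\tfrac1n\sum_{j<i}a_jx_j^k+\tfrac1n\sum_{j\ge i}a_jx_j^{k-1}\Big),y-x_i^{k-1}\Big\rangle+\frac{a_iL_g}{2n}\|y-x_i^{k-1}\|^2+\tilde r_i(y),$$ where $\tilde r_i$ is the convexification of $r_i$. **Theorem.** Let $C=(d\Delta B_g+2B_r)M$, let $\delta>0$, let $K\ge\frac{2C}{m^2L_g}n^{1+2\delta}+1$ be an integer, and let $x^0,\dots,x^K$ be iterates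 of the algorithm. Put $\tau=L_gM\Delta\big(n^{-\delta}+\frac{2\Delta}{n}\big)$. Then there is $k^*\in\{1,\dots,K\}$ such that $x^{k^*}$ is a $\tau$-PNE of $\tilde\Gamma$ that satisfies the full $\tau$-stability condition. Moreover, for every $k^*\le K$ with this property, every generator profile $(Z(i,x^{k^*}))_i$ and every $$x^*\in\operatorname*{argmin}_{x_i\in Z(i,x^{k^*}),\,i\in N}\Big\|\sum_ia_ix_i^{k^*}-\sum_ia_ix_i\Big\|^2,$$ the profile $x^*\in\mathcal X$ is a $$\Big(2L_gM\Delta\Big(n^{-\delta}+\frac{(d+4)\Delta}{n}\Big)+\frac{L_hM\Delta}{n}\Big)\text{-PNE of }\Gamma.$$ In particular (case $\delta=1$) there are constants $A,c$ that depend only on $d,m,M,\Delta,D_1,D_2,B_g,B_r,L_g,L_h$, and not on $n$ or on the game, such that for $K\ge An^3$ a suitable $k^*$ exists as above (with $\delta=1$), and every $x^*$ obtained in this way is a $\frac cn$-PNE of $\Gamma$: an $O(1/n)$-PNE after $O(n^3)$ iterations. -/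

import Mathlib

open Set
open scoped NNReal

/-- The action space `ℝ^d` with its Euclidean norm. -/
abbrev Euc (d : ℕ) : Type := EuclideanSpace ℝ (Fin d)

noncomputable section

/-- The convexification of `φ : S → ℝ` (on the convex hull of `S ⊆ ℝ^d`): the infimum of
`∑ α^k φ(z^k)` over all ways of writing `x` as a convex combination of `d + 1` points of `S`. -/
def convexification {d : ℕ} (S : Set (Euc d)) (φ : Euc d → ℝ) (x : Euc d) : ℝ :=
  sInf {v : ℝ | ∃ (α : Fin (d + 1) → ℝ) (z : Fin (d + 1) → Euc d),
    α ∈ stdSimplex ℝ (Fin (d + 1)) ∧ (∀ k, z k ∈ S) ∧ ∑ k, α k • z k = x ∧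
      v = ∑ k, α k * φ (z k)}

/-- `Z` is a generator of `x`: the set of the points `z^1, …, z^{d+1}` of `S` (repetitions allowed)
of a convex combination with positive weights that represents `x` and attains the infimum in the
definition of the convexification. -/
def IsGenerator {d : ℕ} (S : Set (Euc d)) (φ : Euc d → ℝ) (x : Euc d) (Z : Set (Euc d)) : Prop :=
  ∃ (α : Fin (d + 1) → ℝ) (z : Fin (d + 1) → Euc d),
    (∀ k, 0 < α k) ∧ ∑ k, α k = 1 ∧ (∀ k, z k ∈ S) ∧ ∑ k, α k • z k = x ∧
      ∑ k, α k * φ (z k) = convexification S φ x ∧ Z = range z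

/-- Additively `ε`-approximate pure Nash equilibrium of the game with action sets `X i` and cost
functions `f i` (to be minimized). -/
def IsApproxPNE {n d : ℕ} (X : Fin n → Set (Euc d)) (f : Fin n → (Fin n → Euc d) → ℝ) (ε : ℝ)
    (x : Fin n → Euc d) : Prop :=
  (∀ i, x i ∈ X i) ∧ ∀ i, ∀ y ∈ X i, f i x ≤ f i (Function.update x i y) + ε

/-- Action sets of the convexified game. -/
def convexActions {n d : ℕ} (X : Fin n → Set (Euc d)) (i : Fin n) : Set (Euc d) :=
  convexHull ℝ (X i)

/-- Costs of the convexified game: each cost is convexified in the player's own action. -/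
def convexCost {n d : ℕ} (X : Fin n → Set (Euc d)) (f : Fin n → (Fin n → Euc d) → ℝ) (i : Fin n)
    (x : Fin n → Euc d) : ℝ :=
  convexification (X i) (fun y => f i (Function.update x i y)) (x i)

/-- `Z i` is a generator for `(i, x)`, for every player `i`. -/
def IsGeneratorProfile {n d : ℕ} (X : Fin n → Set (Euc d)) (f : Fin n → (Fin n → Euc d) → ℝ)
    (x : Fin n → Euc d) (Z : Fin n → Set (Euc d)) : Prop :=
  ∀ i, IsGenerator (X i) (fun y => f i (Function.update x i y)) (x i) (Z i)

/-- The `η`-stability condition of `x` with respect to `Z`, in the convexified game. -/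
def IsStableWrt {n d : ℕ} (X : Fin n → Set (Euc d)) (f : Fin n → (Fin n → Euc d) → ℝ) (η : ℝ)
    (x : Fin n → Euc d) (Z : Fin n → Set (Euc d)) : Prop :=
  ∀ i, ∀ y ∈ Z i, convexCost X f i (Function.update x i y) ≤ convexCost X f i x + η

/-- The full `η`-stability condition: stability with respect to every generator profile. -/
def IsFullyStable {n d : ℕ} (X : Fin n → Set (Euc d)) (f : Fin n → (Fin n → Euc d) → ℝ) (η : ℝ)
    (x : Fin n → Euc d) : Prop :=
  ∀ Z, IsGeneratorProfile X f x Z → IsStableWrt X f η x Z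

/-- `xs` minimizes `‖∑ a_i x_i - ∑ a_i y_i‖²` over all `y` with `y_i ∈ Z_i`. -/
def IsDisaggregation {n d : ℕ} (a : Fin n → ℝ) (x : Fin n → Euc d) (Z : Fin n → Set (Euc d))
    (xs : Fin n → Euc d) : Prop :=
  (∀ i, xs i ∈ Z i) ∧ ∀ y : Fin n → Euc d, (∀ i, y i ∈ Z i) →
    ‖∑ i, a i • x i - ∑ i, a i • xs i‖ ^ 2 ≤ ‖∑ i, a i • x i - ∑ i, a i • y i‖ ^ 2

/-- The data of a generalized congestion game with `n` players and actions in `ℝ^d`. -/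
structure CongestionGame (n d : ℕ) where
  /-- action sets -/
  X : Fin n → Set (Euc d)
  /-- weights -/
  a : Fin n → ℝ
  /-- congestion cost per unit, one function for each coordinate -/
  g : Fin d → ℝ → ℝ
  /-- cost terms that depend on the aggregate only -/
  h : Fin n → Euc d → ℝ
  /-- local costs -/
  r : Fin n → Euc d → ℝ

namespace CongestionGame

variable {n d : ℕ}

/-- The aggregate `(1/n) ∑ a_j x_j`. -/
def agg (G : CongestionGame n d) (x : Fin n → Euc d) : Euc d :=
  (1 / (n : ℝ)) • ∑ j, G.a j • x j

/-- The vector `(g_1(y_1), …, g_d(y_d))`. -/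
def gVec (G : CongestionGame n d) (y : Euc d) : Euc d :=
  WithLp.toLp 2 (fun t => G.g t (y t))

/-- The cost `f_i(x) = ⟨g(agg x), x_i⟩ + h_i(agg x) + r_i(x_i)` in the game `Γ`. -/
def cost (G : CongestionGame n d) (i : Fin n) (x : Fin n → Euc d) : ℝ :=
  inner ℝ (G.gVec (G.agg x)) (x i) + G.h i (G.agg x) + G.r i (x i)

/-- The cost in the auxiliary game: in the argument of `g`, the player's own action is replaced by
the fixed action `xp i`, and the term `h_i` is dropped. -/
def auxCost (G : CongestionGame n d) (xp : Fin n → Euc d) (i : Fin n) (x : Fin n → Euc d) : ℝ :=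
  inner ℝ (G.gVec (G.agg (Function.update x i (xp i)))) (x i) + G.r i (x i)

/-- The standing assumptions, with all their constants. -/
structure Assumptions (G : CongestionGame n d) (m M Δ D₁ D₂ Bg Br : ℝ) (Lg Lh : ℝ≥0) : Prop where
  compact : ∀ i, IsCompact (G.X i)
  weight_mem : ∀ i, G.a i ∈ Icc m M
  agg_mem : ∀ x : Fin n → Euc d, (∀ i, x i ∈ convexHull ℝ (G.X i)) →
    ∀ t, G.agg x t ∈ Icc D₁ D₂
  g_lipschitz : ∀ t, LipschitzOnWith Lg (G.g t) (Icc D₁ D₂)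
  g_mono : ∀ t, MonotoneOn (G.g t) (Icc D₁ D₂)
  g_bound : ∀ t, ∀ s ∈ Icc D₁ D₂, |G.g t s| ≤ Bg
  h_lipschitz : ∀ i, LipschitzOnWith Lh (G.h i) {y | ∀ t, y t ∈ Icc D₁ D₂}
  r_bound : ∀ i, ∀ y ∈ G.X i, |G.r i y| ≤ Br
  norm_le : ∀ i, ∀ y ∈ convexHull ℝ (G.X i), ‖y‖ ≤ Δ
  diam_le : ∀ i, ∀ y ∈ convexHull ℝ (G.X i), ∀ y' ∈ convexHull ℝ (G.X i), ‖y - y'‖ ≤ Δ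

/-- The function minimized by player `i` in one step of the gradient-proximal algorithm, where `cur`
lists the current actions of all players and `r̃_i` is the convexification of `r_i`. -/
def proxObjective (G : CongestionGame n d) (Lg : ℝ≥0) (i : Fin n) (cur : Fin n → Euc d)
    (y : Euc d) : ℝ :=
  inner ℝ (G.gVec (G.agg cur)) (y - cur i) + G.a i * Lg / (2 * n) * ‖y - cur i‖ ^ 2
    + convexification (G.X i) (G.r i) y

/-- `x 0, …, x K` are iterates of the gradient-proximal algorithm: in each iteration the players
update one after the other, and player `i` sees the new actions of the players `j < i`. -/
def IsRun (G : CongestionGame n d) (Lg : ℝ≥0) (K : ℕ) (x : ℕ → Fin n → Euc d) : Prop :=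
  (∀ i, x 0 i ∈ convexHull ℝ (G.X i)) ∧
    ∀ k < K, ∀ i, x (k + 1) i ∈ convexHull ℝ (G.X i) ∧
      IsMinOn (G.proxObjective Lg i (fun j => if j < i then x (k + 1) j else x k j))
        (convexHull ℝ (G.X i)) (x (k + 1) i)

/-- The selection criterion for iterates: `x` is a `τ`-PNE of the convexification of the auxiliary
game and satisfies the full `τ`-stability condition there. -/
def IsSelected (G : CongestionGame n d) (xp : Fin n → Euc d) (τ : ℝ) (x : Fin n → Euc d) : Prop :=
  IsApproxPNE (convexActions G.X) (convexCost G.X (G.auxCost xp)) τ x ∧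
    IsFullyStable G.X (G.auxCost xp) τ x

end CongestionGame

/-- The constant `C = (d Δ B_g + 2 B_r) M`. -/
def iterConst (d : ℕ) (M Δ Bg Br : ℝ) : ℝ := (d * Δ * Bg + 2 * Br) * M

end

/-! In the auxiliary game a player's own action no longer enters `g`, so the cost is linear plus
`r_i` in that action, and convexifying it only convexifies `r_i`. The costs `n * ∑ F_t(agg_t) + ∑
a_i r̃_i`, with `F_t` a primitive of `g_t`, form an approximate potential. Each proximal step lowers
it by at least a multiple of the squared step length (`potential_succ_add_le`), while its
oscillation is at most `n * C`. Hence some iteration moves the players by at most `n ^ (-δ)` on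
average.

The proximal optimality conditions of that iteration are first-order conditions at the new profile,
up to a small error in the gradient. They give the equilibrium property. Stability follows because
the convexification is affine along a generator: the condition can be tested at a point beyond
`x_i`, which reverses its direction (`isSelected_of_first_order`).

For the rounding, the Shapley–Folkman lemma selects generator points whose weighted sum misses that
of `x` by at most `d * M * Δ`, whatever `n` is. A minimizing selection does no worse, so the
aggregate moves by `O(1/n)`. Since `r_i = r̃_i` on generators, stability and equilibrium each
contribute one `τ`, and Lipschitz estimates account for the rest. -/

/-! ### Carathéodory reduction and convexification. -/

/-- A convex combination of at least `d + 1` points of `ℝ^d` can be replaced by one of `d + 1` of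
these points with the same barycenter, without increasing the mean of `φ`. -/
theorem exists_reduced_combination {d : ℕ} {S : Set (Euc d)} (φ : Euc d → ℝ) {N : ℕ}
    (hN : d + 1 ≤ N) (α : Fin N → ℝ) (z : Fin N → Euc d) (hα : α ∈ stdSimplex ℝ (Fin N))
    (hz : ∀ k, z k ∈ S) :
    ∃ (β : Fin (d + 1) → ℝ) (y : Fin (d + 1) → Euc d), β ∈ stdSimplex ℝ (Fin (d + 1)) ∧
      (∀ k, y k ∈ S) ∧ ∑ k, β k • y k = ∑ k, α k • z k ∧
      ∑ k, β k * φ (y k) ≤ ∑ k, α k * φ (z k) := by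
  induction N, hN using Nat.le_induction with
  | base => exact ⟨α, z, hα, hz, rfl, le_rfl⟩
  | succ N hN ih =>
    -- At least `d + 2` points, lifted to `Euc d × ℝ` of dimension `d + 1`, are dependent. The sign
    -- of the relation is chosen so that moving along it does not raise the mean of `φ`.
    obtain ⟨c, hc0, hcz, hc1, hcφ⟩ : ∃ c : Fin (N + 1) → ℝ, c ≠ 0 ∧ ∑ k, c k • z k = 0 ∧
        ∑ k, c k = 0 ∧ ∑ k, c k * φ (z k) ≤ 0 := by
      let L : (Fin (N + 1) → ℝ) →ₗ[ℝ] Euc d × ℝ :=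
        (Fintype.linearCombination ℝ z).prod (Fintype.linearCombination ℝ fun _ => (1 : ℝ))
      have hker : LinearMap.ker L ≠ ⊥ := LinearMap.ker_ne_bot_of_finrank_lt (by simp; omega)
      obtain ⟨c, hc, hc0⟩ := (Submodule.ne_bot_iff _).1 hker
      have hc' : (∑ k, c k • z k, ∑ k, c k * (1 : ℝ)) = (0 : Euc d × ℝ) := hc
      simp only [Prod.mk_eq_zero, mul_one] at hc'
      rcases le_total (∑ k, c k * φ (z k)) 0 with h | h
      · exact ⟨c, hc0, hc'.1, hc'.2, h⟩
      · exact ⟨-c, neg_ne_zero.2 hc0, by simp [hc'.1], by simp [hc'.2], by simpa using h⟩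
    have hneg : ∃ j, c j < 0 := by
      by_contra! h
      exact hc0 (funext fun k =>
        (Finset.sum_eq_zero_iff_of_nonneg fun k _ => h k).1 hc1 k (Finset.mem_univ k))
    -- The least ratio is the longest step that keeps all weights nonnegative; the weight at `j`
    -- then vanishes and that point can be dropped.
    obtain ⟨j, hj, hmin⟩ := Finset.exists_min_image
      (Finset.univ.filter fun j => c j < 0) (fun j => α j / -c j)
      (by obtain ⟨j, hj⟩ := hneg; exact ⟨j, by simpa using hj⟩)
    simp only [Finset.mem_filter, Finset.mem_univ, true_and] at hj hmin
    set t := α j / -c j with ht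
    have ht0 : 0 ≤ t := div_nonneg (hα.1 j) (by linarith)
    have hwj : α j + t * c j = 0 := by rw [ht]; field_simp [hj.ne]; ring
    have hw : ∀ k, 0 ≤ α k + t * c k := by
      intro k
      rcases le_or_gt 0 (c k) with h | h
      · have := hα.1 k; positivity
      · have := (le_div_iff₀ (by linarith)).1 (hmin k h)
        linarith
    have h1 : ∑ k, (α k + t * c k) = 1 := by
      rw [Finset.sum_add_distrib, ← Finset.mul_sum, hc1, hα.2]; simp
    have h2 : ∑ k, (α k + t * c k) • z k = ∑ k, α k • z k := by
      simp_rw [add_smul, mul_smul]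
      rw [Finset.sum_add_distrib, ← Finset.smul_sum, hcz]; simp
    have h3 : ∑ k, (α k + t * c k) * φ (z k) ≤ ∑ k, α k * φ (z k) := by
      simp_rw [add_mul, mul_assoc]
      rw [Finset.sum_add_distrib, ← Finset.mul_sum]
      linarith [mul_nonpos_of_nonneg_of_nonpos ht0 hcφ]
    rw [Fin.sum_univ_succAbove _ j, hwj] at h1 h2 h3
    simp only [zero_add, zero_smul, zero_mul] at h1 h2 h3
    obtain ⟨β, y, hβ, hy, hb, hv⟩ := ih (fun k => α (j.succAbove k) + t * c (j.succAbove k))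
      (fun k => z (j.succAbove k)) ⟨fun k => hw _, h1⟩ fun k => hz _
    exact ⟨β, y, hβ, hy, hb.trans h2, hv.trans h3⟩

/-- The set whose infimum is the convexification. -/
def combinationValues {d : ℕ} (S : Set (Euc d)) (φ : Euc d → ℝ) (x : Euc d) : Set ℝ :=
  {v : ℝ | ∃ (α : Fin (d + 1) → ℝ) (z : Fin (d + 1) → Euc d),
    α ∈ stdSimplex ℝ (Fin (d + 1)) ∧ (∀ k, z k ∈ S) ∧ ∑ k, α k • z k = x ∧
      v = ∑ k, α k * φ (z k)}

/-- This is convexity before passing to the infimum. Concatenating two combinations yields `2 * (d +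
1)` points, and the Carathéodory reduction returns to the prescribed number `d + 1`. -/
theorem exists_combinationValues_le {d : ℕ} {S : Set (Euc d)} {φ : Euc d → ℝ} {x y : Euc d}
    {v w s t : ℝ} (hv : v ∈ combinationValues S φ x) (hw : w ∈ combinationValues S φ y)
    (hs : 0 ≤ s) (ht : 0 ≤ t) (hst : s + t = 1) :
    ∃ u ∈ combinationValues S φ (s • x + t • y), u ≤ s * v + t * w := by
  obtain ⟨α, z, hα, hz, hzx, rfl⟩ := hv
  obtain ⟨β, z', hβ, hz', hzy, rfl⟩ := hw
  obtain ⟨γ, p, hγ, hp, hpx, hpv⟩ := exists_reduced_combination (S := S) φ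
    (N := (d + 1) + (d + 1)) (by omega)
    (Fin.append (fun k => s * α k) (fun k => t * β k)) (Fin.append z z')
    ⟨fun k => by
      refine Fin.addCases (fun k => ?_) (fun k => ?_) k
      · simpa using mul_nonneg hs (hα.1 k)
      · simpa [-Fin.natAdd_eq_addNat] using mul_nonneg ht (hβ.1 k), by
      rw [Fin.sum_univ_add]
      simp [-Fin.natAdd_eq_addNat, ← Finset.mul_sum, hα.2, hβ.2, hst]⟩
    (fun k => Fin.addCases (fun k => by simpa using hz k)
      (fun k => by simpa [-Fin.natAdd_eq_addNat] using hz' k) k)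
  refine ⟨_, ⟨γ, p, hγ, hp, ?_, rfl⟩, ?_⟩
  · rw [hpx, Fin.sum_univ_add]
    simp [-Fin.natAdd_eq_addNat, mul_smul, ← Finset.smul_sum, hzx, hzy]
  · refine hpv.trans_eq ?_
    rw [Fin.sum_univ_add]
    simp [-Fin.natAdd_eq_addNat, mul_assoc, ← Finset.mul_sum]

theorem self_mem_combinationValues {d : ℕ} {S : Set (Euc d)} (φ : Euc d → ℝ) {x : Euc d}
    (hx : x ∈ S) : φ x ∈ combinationValues S φ x :=
  ⟨Pi.single 0 1, fun _ => x, single_mem_stdSimplex ℝ 0, fun _ => hx, by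
    rw [← Finset.sum_smul]; simp, by rw [← Finset.sum_mul]; simp⟩

theorem combinationValues_nonempty {d : ℕ} {S : Set (Euc d)} (φ : Euc d → ℝ) {x : Euc d}
    (hx : x ∈ convexHull ℝ S) : (combinationValues S φ x).Nonempty := by
  refine convexHull_min (t := {x | (combinationValues S φ x).Nonempty})
    (fun y hy => ⟨_, self_mem_combinationValues φ hy⟩) ?_ hx
  rintro x ⟨v, hv⟩ y ⟨w, hw⟩ s t hs ht hst
  obtain ⟨u, hu, -⟩ := exists_combinationValues_le hv hw hs ht hst
  exact ⟨u, hu⟩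

theorem abs_le_of_mem_combinationValues {d : ℕ} {S : Set (Euc d)} {φ : Euc d → ℝ} {B : ℝ}
    (hφ : ∀ y ∈ S, |φ y| ≤ B) {x : Euc d} {v : ℝ} (hv : v ∈ combinationValues S φ x) :
    |v| ≤ B := by
  obtain ⟨α, z, hα, hz, -, rfl⟩ := hv
  calc |∑ k, α k * φ (z k)| ≤ ∑ k, |α k * φ (z k)| := Finset.abs_sum_le_sum_abs _ _
    _ ≤ ∑ k, α k * B := Finset.sum_le_sum fun k _ => by
        rw [abs_mul, abs_of_nonneg (hα.1 k)]
        exact mul_le_mul_of_nonneg_left (hφ _ (hz k)) (hα.1 k)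
    _ = B := by rw [← Finset.sum_mul, hα.2, one_mul]

theorem bddBelow_combinationValues {d : ℕ} {S : Set (Euc d)} {φ : Euc d → ℝ} {B : ℝ}
    (hφ : ∀ y ∈ S, |φ y| ≤ B) (x : Euc d) : BddBelow (combinationValues S φ x) :=
  ⟨-B, fun _ hv => (abs_le.1 (abs_le_of_mem_combinationValues hφ hv)).1⟩

theorem convexification_le {d : ℕ} {S : Set (Euc d)} {φ : Euc d → ℝ} {B : ℝ}
    (hφ : ∀ y ∈ S, |φ y| ≤ B) {x : Euc d} {v : ℝ} (hv : v ∈ combinationValues S φ x) :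
    convexification S φ x ≤ v :=
  csInf_le (bddBelow_combinationValues hφ x) hv

theorem convexification_le_self {d : ℕ} {S : Set (Euc d)} {φ : Euc d → ℝ} {B : ℝ}
    (hφ : ∀ y ∈ S, |φ y| ≤ B) {x : Euc d} (hx : x ∈ S) : convexification S φ x ≤ φ x :=
  convexification_le hφ (self_mem_combinationValues φ hx)

theorem abs_convexification_le {d : ℕ} {S : Set (Euc d)} {φ : Euc d → ℝ} {B : ℝ}
    (hφ : ∀ y ∈ S, |φ y| ≤ B) {x : Euc d} (hx : x ∈ convexHull ℝ S) :
    |convexification S φ x| ≤ B := by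
  obtain ⟨v, hv⟩ := combinationValues_nonempty φ hx
  exact abs_le.2 ⟨le_csInf ⟨v, hv⟩
    fun _ hw => (abs_le.1 (abs_le_of_mem_combinationValues hφ hw)).1,
    (convexification_le hφ hv).trans (abs_le.1 (abs_le_of_mem_combinationValues hφ hv)).2⟩

theorem convexOn_convexification {d : ℕ} {S : Set (Euc d)} {φ : Euc d → ℝ} {B : ℝ}
    (hφ : ∀ y ∈ S, |φ y| ≤ B) : ConvexOn ℝ (convexHull ℝ S) (convexification S φ) := by
  refine ⟨convex_convexHull ℝ S, fun x hx y hy s t hs ht hst => le_of_forall_pos_le_add ?_⟩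
  intro ε hε
  obtain ⟨v, hv, hvε⟩ := exists_lt_of_csInf_lt (combinationValues_nonempty φ hx)
    (lt_add_of_pos_right (convexification S φ x) hε)
  obtain ⟨w, hw, hwε⟩ := exists_lt_of_csInf_lt (combinationValues_nonempty φ hy)
    (lt_add_of_pos_right (convexification S φ y) hε)
  obtain ⟨u, hu, huv⟩ := exists_combinationValues_le hv hw hs ht hst
  have h1 := convexification_le hφ hu
  have h2 := mul_le_mul_of_nonneg_left hvε.le hs
  have h3 := mul_le_mul_of_nonneg_left hwε.le ht
  have h4 : s * ε + t * ε = ε := by rw [← add_mul, hst, one_mul]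
  simp only [smul_eq_mul]
  linarith

/-- A linear term passes through the convexification. -/
theorem convexification_inner_add {d : ℕ} {S : Set (Euc d)} {φ : Euc d → ℝ} {B : ℝ}
    (hφ : ∀ y ∈ S, |φ y| ≤ B) (c : Euc d) {x : Euc d} (hx : x ∈ convexHull ℝ S) :
    convexification S (fun y => inner ℝ c y + φ y) x =
      inner ℝ c x + convexification S φ x := by
  have hset : combinationValues S (fun y => inner ℝ c y + φ y) x =
      (fun v => inner ℝ c x + v) '' combinationValues S φ x := by
    have key : ∀ (α : Fin (d + 1) → ℝ) (z : Fin (d + 1) → Euc d), ∑ k, α k • z k = x →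
        ∑ k, α k * (inner ℝ c (z k) + φ (z k)) = inner ℝ c x + ∑ k, α k * φ (z k) := by
      rintro α z rfl
      simp [inner_sum, inner_smul_right, mul_add, Finset.sum_add_distrib]
    ext v
    constructor
    · rintro ⟨α, z, hα, hz, hx, rfl⟩
      exact ⟨_, ⟨α, z, hα, hz, hx, rfl⟩, (key α z hx).symm⟩
    · rintro ⟨_, ⟨α, z, hα, hz, hx, rfl⟩, rfl⟩
      exact ⟨α, z, hα, hz, hx, (key α z hx).symm⟩
  have h := Monotone.map_csInf_of_continuousAt (f := fun v : ℝ => inner ℝ c x + v)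
    (by fun_prop) (fun _ _ h => by simpa using h) (combinationValues_nonempty φ hx)
    (bddBelow_combinationValues hφ x)
  change sInf (combinationValues S (fun y => inner ℝ c y + φ y) x) =
    inner ℝ c x + sInf (combinationValues S φ x)
  rw [hset, ← h]

/-- On a generator, `φ` agrees with its convexification, and the convexification is affine: it can
be extrapolated from a point of the generator through `x`. -/
theorem IsGenerator.eq_and_exists_extrapolation {d : ℕ} {S : Set (Euc d)} {φ : Euc d → ℝ} {B : ℝ}
    (hφ : ∀ y ∈ S, |φ y| ≤ B) {x : Euc d} {c : Euc d} {Z : Set (Euc d)}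
    (hZ : IsGenerator S (fun y => inner ℝ c y + φ y) x Z) {z : Euc d} (hz : z ∈ Z) :
    convexification S φ z = φ z ∧ ∃ ε : ℝ, 0 < ε ∧ x + ε • (x - z) ∈ convexHull ℝ S ∧
      convexification S φ (x + ε • (x - z)) ≤ convexification S φ x +
        ε * (convexification S φ x - convexification S φ z) := by
  obtain ⟨α, w, hα, hα1, hw, hwx, hval, rfl⟩ := hZ
  obtain ⟨j, rfl⟩ := hz
  have hmem : ∀ k, w k ∈ convexHull ℝ S := fun k => subset_convexHull ℝ S (hw k)
  have hx : x ∈ convexHull ℝ S := hwx ▸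
    (convex_convexHull ℝ S).sum_mem (fun k _ => (hα k).le) hα1 fun k _ => hmem k
  rw [convexification_inner_add hφ c hx] at hval
  have hval' : ∑ k, α k * φ (w k) = convexification S φ x := by
    have : ∑ k, α k * (inner ℝ c (w k) + φ (w k)) = inner ℝ c x + ∑ k, α k * φ (w k) := by
      rw [← hwx]
      simp [inner_sum, inner_smul_right, mul_add, Finset.sum_add_distrib]
    linarith
  have hle : ∀ k, convexification S φ (w k) ≤ φ (w k) := fun k => convexification_le_self hφ (hw k)
  -- Jensen for the convexification and its termwise bound by `φ` squeeze the two weighted sums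
  -- together; as all weights are positive, every term is an equality.
  have heq : convexification S φ (w j) = φ (w j) := by
    have hJ := (convexOn_convexification hφ).map_sum_le (fun k _ => (hα k).le) hα1
      (t := Finset.univ) (p := w) fun k _ => hmem k
    rw [hwx, ← hval'] at hJ
    simp only [smul_eq_mul] at hJ
    have h0 : ∑ k, (α k * φ (w k) - α k * convexification S φ (w k)) = 0 :=
      le_antisymm (by rw [Finset.sum_sub_distrib]; linarith) (Finset.sum_nonneg fun k _ => by
        have := mul_le_mul_of_nonneg_left (hle k) (hα k).le; linarith)
    have h1 := (Finset.sum_eq_zero_iff_of_nonneg fun k _ => by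
        have := mul_le_mul_of_nonneg_left (hle k) (hα k).le; linarith).1 h0 j (Finset.mem_univ j)
    exact (mul_left_cancel₀ (hα j).ne' (sub_eq_zero.1 h1)).symm
  refine ⟨heq, α j, hα j, ?_⟩
  -- These weights represent `(1 + α j) • x - α j • w j`. The one at `j` is `(α j) ^ 2`, so with `ε
  -- = α j` they remain nonnegative.
  set β : Fin (d + 1) → ℝ := fun k => (1 + α j) * α k - α j * (Pi.single j 1 : Fin (d + 1) → ℝ) k
    with hβdef
  have hβ : β ∈ stdSimplex ℝ (Fin (d + 1)) := by
    refine ⟨fun k => ?_, ?_⟩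
    · by_cases hk : k = j
      · subst hk
        simp only [hβdef, Pi.single_eq_same]
        nlinarith [hα k]
      · simp only [hβdef, Pi.single_eq_of_ne hk]
        nlinarith [hα k, hα j]
    · simp only [hβdef, Finset.sum_sub_distrib, ← Finset.mul_sum, hα1]
      simp
  have hβx : ∑ k, β k • w k = x + α j • (x - w j) := by
    simp only [hβdef, sub_smul, mul_smul, Finset.sum_sub_distrib, ← Finset.smul_sum, hwx]
    simp only [Pi.single_apply, ite_smul, one_smul, zero_smul, Finset.sum_ite_eq',
      Finset.mem_univ, if_true]
    module
  refine ⟨hβx ▸ (convex_convexHull ℝ S).sum_mem (fun k _ => hβ.1 k) hβ.2 fun k _ => hmem k, ?_⟩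
  refine (convexification_le hφ ⟨β, w, hβ, hw, hβx, rfl⟩).trans_eq ?_
  simp only [hβdef, sub_mul, mul_assoc, Finset.sum_sub_distrib, ← Finset.mul_sum, hval', heq]
  simp only [Pi.single_apply, ite_mul, one_mul, zero_mul, Finset.sum_ite_eq', Finset.mem_univ,
    if_true]
  ring

/-! ### Shapley–Folkman and rounding. -/

/-- The Shapley–Folkman lemma: a weighted sum of points of the convex hulls of finite sets `Z i` is
also the weighted sum of points of these hulls of which all but `finrank E` lie in `Z i`. -/
theorem exists_sum_eq_card_notMem_le_finrank {ι E : Type*} [Fintype ι] [NormedAddCommGroup E]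
    [NormedSpace ℝ E] [FiniteDimensional ℝ E] (a : ι → ℝ) (Z : ι → Set E) (hZ : ∀ i, (Z i).Finite)
    (x : ι → E) (hx : ∀ i, x i ∈ convexHull ℝ (Z i)) :
    ∃ p : ι → E, (∀ i, p i ∈ convexHull ℝ (Z i)) ∧ ∑ i, a i • p i = ∑ i, a i • x i ∧
      {i | p i ∉ Z i}.ncard ≤ Module.finrank ℝ E := by
  classical
  set P : Set (ι → E) := univ.pi (fun i => convexHull ℝ (Z i)) ∩
    {p | ∑ i, a i • p i = ∑ i, a i • x i} with hP
  have hcomp : IsCompact P := (isCompact_univ_pi fun i => (hZ i).isCompact_convexHull ℝ).inter_right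
    (isClosed_eq (f := fun p : ι → E => ∑ i, a i • p i) (by fun_prop) continuous_const)
  -- An extreme point of the fibre works: with too many coordinates outside `Z i`, it could be
  -- perturbed both ways inside the fibre.
  obtain ⟨p, hp⟩ := hcomp.extremePoints_nonempty ⟨x, fun i _ => hx i, rfl⟩
  have hpP := hp.1
  refine ⟨p, fun i => hpP.1 i (mem_univ i), hpP.2, ?_⟩
  by_contra! hcard
  have hv : ∀ i, ∃ v : E, (p i ∉ Z i → v ≠ 0) ∧ p i + v ∈ convexHull ℝ (Z i) ∧
      p i - v ∈ convexHull ℝ (Z i) := by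
    intro i
    by_cases hi : p i ∈ Z i
    · exact ⟨0, fun h => (h hi).elim, by simpa using hpP.1 i (mem_univ i),
        by simpa using hpP.1 i (mem_univ i)⟩
    · have hne : p i ∉ (convexHull ℝ (Z i)).extremePoints ℝ :=
        fun h => hi (extremePoints_convexHull_subset h)
      have hmem := hpP.1 i (mem_univ i)
      rw [mem_extremePoints_iff_left] at hne
      push Not at hne
      obtain ⟨y, hy, z, hz, ⟨s, t, hs, ht, hst, hyz⟩, hne⟩ := hne hmem
      have hseg : ∀ c : ℝ, -s ≤ c → c ≤ t → p i + c • (y - z) ∈ convexHull ℝ (Z i) := by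
        intro c h1 h2
        convert convex_convexHull ℝ (Z i) hy hz (a := s + c) (b := t - c) (by linarith)
          (by linarith) (by linarith) using 1
        rw [← hyz]
        module
      have hmin : 0 < min s t := lt_min hs ht
      refine ⟨min s t • (y - z), fun _ => smul_ne_zero hmin.ne' (sub_ne_zero.2 ?_),
        hseg _ (by linarith) (min_le_right s t), ?_⟩
      · rintro rfl
        exact hne (by rw [← hyz, ← add_smul, hst, one_smul])
      · rw [sub_eq_add_neg, ← neg_smul]
        exact hseg _ (by linarith [min_le_left s t]) (by linarith)
  choose v hv0 hvp hvm using hv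
  set T : Finset ι := Finset.univ.filter fun i => p i ∉ Z i with hT
  have hTcard : Module.finrank ℝ E < Fintype.card T := by
    rw [Fintype.card_coe, hT]
    rwa [Set.ncard_eq_toFinset_card', Set.toFinset_ofPred] at hcard
  have hker := LinearMap.ker_ne_bot_of_finrank_lt
    (f := Fintype.linearCombination ℝ fun i : T => a i • v i) (by simpa using hTcard)
  obtain ⟨c, hc, hc0⟩ := (Submodule.ne_bot_iff _).1 hker
  have hC : 0 < ∑ i, |c i| := by
    obtain ⟨i, hi⟩ := Function.ne_iff.1 hc0
    exact Finset.sum_pos' (fun i _ => abs_nonneg _) ⟨i, Finset.mem_univ i, abs_pos.2 hi⟩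
  -- Normalizing the linear relation gives `|e i| ≤ 1`, so `p i ± e i • v i` stays between `p i - v
  -- i` and `p i + v i`.
  set e : ι → ℝ := fun i => if h : i ∈ T then c ⟨i, h⟩ / ∑ i, |c i| else 0 with he
  have he1 : ∀ i, |e i| ≤ 1 := by
    intro i
    by_cases h : i ∈ T
    · simp only [he, h, dif_pos, abs_div, abs_of_pos hC]
      exact (div_le_one hC).2 (Finset.single_le_sum (f := fun i => |c i|)
        (fun i _ => abs_nonneg _) (Finset.mem_univ _))
    · simp [he, h]
  have hsum : ∑ i, a i • e i • v i = 0 := by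
    have h0 : ∑ i : T, c i • a i • v i = 0 := hc
    rw [← Finset.sum_subset (Finset.subset_univ T) fun i _ h => by simp [he, h],
      ← Finset.sum_coe_sort, ← smul_zero (∑ i, |c i|)⁻¹, ← h0, Finset.smul_sum]
    refine Finset.sum_congr rfl fun i _ => ?_
    simp only [he, i.2, dif_pos, Subtype.coe_eta, div_eq_inv_mul, smul_smul]
    ring_nf
  have hmem : ∀ σ : ℝ, |σ| = 1 → (fun i => p i + (σ * e i) • v i) ∈ P := by
    intro σ hσ
    refine ⟨fun i _ => ?_, ?_⟩
    · have h : -1 ≤ σ * e i ∧ σ * e i ≤ 1 :=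
        abs_le.1 ((abs_mul σ (e i)).trans_le (by rw [hσ, one_mul]; exact he1 i))
      convert convex_convexHull ℝ (Z i) (hvp i) (hvm i) (a := (1 + σ * e i) / 2)
        (b := (1 - σ * e i) / 2) (by linarith) (by linarith) (by ring) using 1
      module
    · have h : ∀ i, a i • (σ * e i) • v i = σ • a i • e i • v i := fun i => by
        simp only [smul_smul]; ring_nf
      simp only [mem_ofPred_eq, smul_add, Finset.sum_add_distrib, h]
      rw [← Finset.smul_sum, hsum, smul_zero, add_zero]
      exact hpP.2
  have heq := (mem_extremePoints_iff_left.1 hp).2 _ (hmem 1 (by simp)) _ (hmem (-1) (by simp))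
    ⟨1 / 2, 1 / 2, by norm_num, by norm_num, by norm_num, by ext i; simp; module⟩
  obtain ⟨i, hi⟩ := Function.ne_iff.1 hc0
  have hvi : v i ≠ 0 := hv0 i (Finset.mem_filter.1 i.2).2
  have hei : e i = 0 := by simpa [hvi] using congrFun heq i
  simp only [he, i.2, dif_pos, Subtype.coe_eta] at hei
  exact hi ((div_eq_zero_iff.1 hei).resolve_right hC.ne')

/-- Rounding of a weighted sum of points of convex hulls, with an error that does not depend on the
number of summands. -/
theorem exists_norm_sum_sub_sum_le {ι E : Type*} [Fintype ι] [NormedAddCommGroup E]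
    [NormedSpace ℝ E] [FiniteDimensional ℝ E] (a : ι → ℝ) (Z : ι → Set E) (hZ : ∀ i, (Z i).Finite)
    (x : ι → E) (hx : ∀ i, x i ∈ convexHull ℝ (Z i)) {R : ℝ} (hR : 0 ≤ R)
    (hdiam : ∀ i, ∀ y ∈ convexHull ℝ (Z i), ∀ z ∈ Z i, ‖a i • (y - z)‖ ≤ R) :
    ∃ y : ι → E, (∀ i, y i ∈ Z i) ∧
      ‖∑ i, a i • x i - ∑ i, a i • y i‖ ≤ Module.finrank ℝ E * R := by
  classical
  obtain ⟨p, hp, hpx, hcard⟩ := exists_sum_eq_card_notMem_le_finrank a Z hZ x hx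
  have hne : ∀ i, (Z i).Nonempty := fun i => convexHull_nonempty_iff.1 ⟨_, hx i⟩
  refine ⟨fun i => if p i ∈ Z i then p i else (hne i).some, fun i => ?_, ?_⟩
  · by_cases h : p i ∈ Z i
    · simp [h]
    · simpa [h] using (hne i).some_mem
  rw [← hpx, ← Finset.sum_sub_distrib]
  refine (norm_sum_le _ _).trans ?_
  calc ∑ i, ‖a i • p i - a i • (if p i ∈ Z i then p i else (hne i).some)‖
      ≤ ∑ i, if p i ∉ Z i then R else 0 := Finset.sum_le_sum fun i _ => by
        by_cases h : p i ∈ Z i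
        · simp [h]
        · simpa [h, smul_sub] using hdiam i _ (hp i) _ (hne i).some_mem
    _ = {i | p i ∉ Z i}.ncard * R := by
        rw [← Finset.sum_filter, Finset.sum_const, nsmul_eq_mul, Set.ncard_eq_toFinset_card',
          Set.toFinset_ofPred]
    _ ≤ _ := by gcongr

/-! ### Proximal steps and primitives of Lipschitz functions. -/

/-- First-order optimality for a proximal step. -/
theorem IsMinOn.prox_first_order {E : Type*} [NormedAddCommGroup E] [InnerProductSpace ℝ E]
    {s : Set E} {ρ : E → ℝ} (hρ : ConvexOn ℝ s ρ) {c p x : E} {β : ℝ}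
    (hx : x ∈ s) (hmin : IsMinOn (fun y => inner ℝ c (y - p) + β / 2 * ‖y - p‖ ^ 2 + ρ y) s x)
    {y : E} (hy : y ∈ s) : 0 ≤ inner ℝ (c + β • (x - p)) (y - x) + ρ y - ρ x := by
  set D := inner ℝ (c + β • (x - p)) (y - x) + ρ y - ρ x with hD
  -- Minimality is tested at `(1 - t) • x + t • y` and divided by `t`; the quadratic remainder
  -- disappears as `t` tends to `0`.
  have key : ∀ t : ℝ, 0 < t → t ≤ 1 → 0 ≤ D + t * (β / 2 * ‖y - x‖ ^ 2) := by
    intro t ht ht1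
    have hmem : (1 - t) • x + t • y ∈ s := hρ.1 hx hy (by linarith) ht.le (by ring)
    have h1 := hmin hmem
    have h2 := hρ.2 hx hy (sub_nonneg.2 ht1) ht.le (by ring)
    simp only [mem_ofPred_eq] at h1
    have h3 : (1 - t) • x + t • y - p = (x - p) + t • (y - x) := by module
    rw [h3, norm_add_sq_real, inner_add_right, inner_smul_right, inner_smul_right, norm_smul,
      Real.norm_of_nonneg ht.le] at h1
    simp only [smul_eq_mul] at h2
    have h4 : 0 ≤ t * (D + t * (β / 2 * ‖y - x‖ ^ 2)) := by
      rw [hD, inner_add_left, real_inner_smul_left]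
      nlinarith
    exact nonneg_of_mul_nonneg_right h4 ht
  refine ge_of_tendsto (x := nhdsWithin (0 : ℝ) (Ioi 0))
    (f := fun t => D + t * (β / 2 * ‖y - x‖ ^ 2)) ?_ ?_
  · have : ContinuousAt (fun t : ℝ => D + t * (β / 2 * ‖y - x‖ ^ 2)) 0 := by fun_prop
    simpa [ContinuousAt] using this.tendsto.mono_left nhdsWithin_le_nhds
  · filter_upwards [Ioc_mem_nhdsGT (zero_lt_one (α := ℝ))] with t ht using key t ht.1 ht.2

/-- A Lipschitz function has a primitive on an interval that satisfies the quadratic upper bound. -/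
theorem LipschitzOnWith.exists_primitive {f : ℝ → ℝ} {L : ℝ≥0} {a b : ℝ}
    (hf : LipschitzOnWith L f (Icc a b)) :
    ∃ F : ℝ → ℝ, (∀ u ∈ Icc a b, ∀ v ∈ Icc a b,
      F v - F u ≤ f u * (v - u) + L / 2 * (v - u) ^ 2) ∧
      ∀ B : ℝ, (∀ u ∈ Icc a b, |f u| ≤ B) →
        ∀ u ∈ Icc a b, ∀ v ∈ Icc a b, |F v - F u| ≤ B * |v - u| := by
  obtain ⟨g, hg, hfg⟩ := hf.extend_real
  have hint : ∀ u v, IntervalIntegrable g MeasureTheory.volume u v :=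
    fun u v => hg.continuous.intervalIntegrable u v
  have hF : ∀ u v, (∫ t in a..v, g t) - ∫ t in a..u, g t = ∫ t in u..v, g t :=
    fun u v => intervalIntegral.integral_interval_sub_left (hint _ _) (hint _ _)
  refine ⟨fun u => ∫ t in a..u, g t, fun u hu v hv => ?_, fun B hB u hu v hv => ?_⟩
  · rw [hF, hfg hu]
    have hlip : ∀ t, |g t - g u| ≤ L * |t - u| := fun t => by
      simpa [Real.dist_eq] using hg.dist_le_mul t u
    -- The same linear integrand serves both orientations: it lies above `g` to the right of `u` and
    -- below `g` to the left, where the integral changes sign.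
    have hlin : ∫ t in u..v, (g u + L * (t - u)) = g u * (v - u) + L / 2 * (v - u) ^ 2 := by
      rw [intervalIntegral.integral_add (by simp) (by apply Continuous.intervalIntegrable; fun_prop),
        intervalIntegral.integral_const_mul, intervalIntegral.integral_sub (by simp) (by simp)]
      simp
      ring
    rw [← hlin]
    rcases le_total u v with h | h
    · refine intervalIntegral.integral_mono_on h (hint _ _)
        (by apply Continuous.intervalIntegrable; fun_prop) fun t ht => ?_
      have h1 := (abs_le.1 (hlip t)).2
      rw [abs_of_nonneg (by linarith [ht.1])] at h1
      linarith
    · rw [intervalIntegral.integral_symm v u, intervalIntegral.integral_symm v u, neg_le_neg_iff]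
      refine intervalIntegral.integral_mono_on h
        (by apply Continuous.intervalIntegrable; fun_prop) (hint _ _) fun t ht => ?_
      have h1 := (abs_le.1 (hlip t)).1
      rw [abs_of_nonpos (by linarith [ht.2])] at h1
      linarith
  · rw [hF, ← Real.norm_eq_abs (∫ t in u..v, g t)]
    refine intervalIntegral.norm_integral_le_of_norm_le_const fun t ht => ?_
    have ht' : t ∈ Icc a b := ⟨(le_min hu.1 hv.1).trans ht.1.le, ht.2.trans (max_le hu.2 hv.2)⟩
    rw [← hfg ht']
    exact hB t ht'

/-! ### The auxiliary game and its first-order conditions. -/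

namespace CongestionGame

variable {n d : ℕ} {G : CongestionGame n d} {m M Δ D₁ D₂ Bg Br : ℝ} {Lg Lh : ℝ≥0}

/-- The convexified local cost of player `i`. -/
noncomputable abbrev localConv (G : CongestionGame n d) (i : Fin n) : Euc d → ℝ :=
  convexification (G.X i) (G.r i)

theorem agg_sub_agg (x y : Fin n → Euc d) :
    G.agg x - G.agg y = (1 / (n : ℝ)) • ∑ j, G.a j • (x j - y j) := by
  simp [agg, smul_sub, Finset.sum_sub_distrib]

theorem agg_update (x : Fin n → Euc d) (i : Fin n) (p : Euc d) :
    G.agg (Function.update x i p) = G.agg x + (G.a i / n) • (p - x i) := by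
  rw [← sub_eq_iff_eq_add', agg_sub_agg, Finset.sum_eq_single i]
  · simp [smul_smul, div_eq_inv_mul]
  · intro j _ hj
    simp [Function.update_of_ne hj]
  · simp

theorem update_mem_convexHull {x : Fin n → Euc d} (hx : ∀ i, x i ∈ convexHull ℝ (G.X i))
    {i : Fin n} {p : Euc d} (hp : p ∈ convexHull ℝ (G.X i)) (j : Fin n) :
    Function.update x i p j ∈ convexHull ℝ (G.X j) := by
  by_cases h : j = i
  · subst h; simpa using hp
  · simpa [Function.update_of_ne h] using hx j

namespace Assumptions

variable (H : G.Assumptions m M Δ D₁ D₂ Bg Br Lg Lh)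
include H

theorem weight_nonneg (hm : 0 < m) (i : Fin n) : 0 ≤ G.a i := hm.le.trans (H.weight_mem i).1

theorem norm_agg_sub_le (hm : 0 < m) (x y : Fin n → Euc d) :
    ‖G.agg x - G.agg y‖ ≤ M * (1 / n * ∑ j, ‖x j - y j‖) := by
  rw [agg_sub_agg, norm_smul, Real.norm_of_nonneg (by positivity), mul_left_comm, Finset.mul_sum]
  gcongr
  refine norm_sum_le_of_le _ fun j _ => ?_
  rw [norm_smul, Real.norm_of_nonneg (H.weight_nonneg hm j)]
  gcongr
  exact (H.weight_mem j).2

theorem norm_gVec_sub_le {u v : Euc d} (hu : ∀ t, u t ∈ Icc D₁ D₂) (hv : ∀ t, v t ∈ Icc D₁ D₂) :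
    ‖G.gVec u - G.gVec v‖ ≤ Lg * ‖u - v‖ := by
  refine (sq_le_sq₀ (norm_nonneg _) (by positivity)).1 ?_
  rw [mul_pow, EuclideanSpace.norm_sq_eq, EuclideanSpace.norm_sq_eq, Finset.mul_sum]
  refine Finset.sum_le_sum fun t _ => ?_
  rw [← mul_pow]
  have := (H.g_lipschitz t).dist_le_mul _ (hu t) _ (hv t)
  rw [Real.dist_eq, Real.dist_eq] at this
  gcongr
  simpa [gVec] using this

/-- The fixed action `xp i` makes the argument of `g` independent of `y`, so the linear term passes
through the convexification. -/
theorem convexCost_update (xp x : Fin n → Euc d) (i : Fin n) {y : Euc d}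
    (hy : y ∈ convexHull ℝ (G.X i)) :
    convexCost G.X (G.auxCost xp) i (Function.update x i y) =
      inner ℝ (G.gVec (G.agg (Function.update x i (xp i)))) y + G.localConv i y := by
  rw [← convexification_inner_add (H.r_bound i) _ hy]
  simp [convexCost, auxCost]

theorem convexCost_eq (xp x : Fin n → Euc d) (i : Fin n) (hx : x i ∈ convexHull ℝ (G.X i)) :
    convexCost G.X (G.auxCost xp) i x =
      inner ℝ (G.gVec (G.agg (Function.update x i (xp i)))) (x i) + G.localConv i (x i) := by
  simpa using H.convexCost_update xp x i hx

/-- A profile that satisfies perturbed first-order optimality conditions is selected. -/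
theorem isSelected_of_first_order {xp x : Fin n → Euc d} {κ : ℝ}
    (hx : ∀ i, x i ∈ convexHull ℝ (G.X i))
    (hopt : ∀ i, ∃ w : Euc d, ‖G.gVec (G.agg (Function.update x i (xp i))) - w‖ ≤ κ ∧
      ∀ y ∈ convexHull ℝ (G.X i),
        0 ≤ inner ℝ w (y - x i) + G.localConv i y - G.localConv i (x i)) :
    G.IsSelected xp (κ * Δ) x := by
  have hκ : ∀ i (w y z : Euc d), ‖G.gVec (G.agg (Function.update x i (xp i))) - w‖ ≤ κ →
      y ∈ convexHull ℝ (G.X i) → z ∈ convexHull ℝ (G.X i) →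
      inner ℝ (G.gVec (G.agg (Function.update x i (xp i))) - w) (y - z) ≤ κ * Δ :=
    fun i w y z hw hy hz => (real_inner_le_norm _ _).trans
      (mul_le_mul hw (H.diam_le i y hy z hz) (norm_nonneg _) ((norm_nonneg _).trans hw))
  refine ⟨⟨hx, fun i y hy => ?_⟩, fun Z hZ i z hz => ?_⟩
  · obtain ⟨w, hw, hfo⟩ := hopt i
    rw [H.convexCost_update xp x i hy, H.convexCost_eq xp x i (hx i)]
    have h1 := hκ i w _ _ hw (hx i) hy
    have h2 := hfo y hy
    simp only [inner_sub_left, inner_sub_right] at h1 h2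
    linarith
  · obtain ⟨w, hw, hfo⟩ := hopt i
    have hgen : IsGenerator (G.X i) (fun y =>
        inner ℝ (G.gVec (G.agg (Function.update x i (xp i)))) y + G.r i y) (x i) (Z i) := by
      simpa [auxCost] using hZ i
    obtain ⟨-, ε, hε, hmem, hle⟩ := hgen.eq_and_exists_extrapolation (H.r_bound i) hz
    have hzX : z ∈ convexHull ℝ (G.X i) := by
      obtain ⟨-, w, -, -, hwX, -, -, hZw⟩ := hgen
      rw [hZw] at hz
      obtain ⟨k, rfl⟩ := hz
      exact subset_convexHull ℝ _ (hwX k)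
    rw [H.convexCost_update xp x i hzX, H.convexCost_eq xp x i (hx i)]
    have h1 := hκ i w _ _ hw hzX (hx i)
    -- At the extrapolated point the displacement from `x i` is `ε • (x i - z)`; dividing by `ε`
    -- gives the inequality opposite to the one tested at `z`.
    have h2 := hfo _ hmem
    rw [add_sub_cancel_left, inner_smul_right] at h2
    have h3 : 0 ≤ inner ℝ w (x i - z) + (G.localConv i (x i) - G.localConv i z) :=
      by
      refine nonneg_of_mul_nonneg_right (a := ε) ?_ hε
      rw [mul_add]
      linarith
    simp only [inner_sub_left, inner_sub_right] at h1 h3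
    linarith

theorem prox_first_order {K : ℕ} {x : ℕ → Fin n → Euc d} (hrun : G.IsRun Lg K x) {k : ℕ}
    (hk : k < K) (i : Fin n) {y : Euc d} (hy : y ∈ convexHull ℝ (G.X i)) :
    0 ≤ inner ℝ (G.gVec (G.agg fun j => if j < i then x (k + 1) j else x k j) +
        (G.a i * Lg / n) • (x (k + 1) i - x k i)) (y - x (k + 1) i) +
      G.localConv i y - G.localConv i (x (k + 1) i) := by
  obtain ⟨hmem, hmin⟩ := hrun.2 k hk i
  refine IsMinOn.prox_first_order (convexOn_convexification (H.r_bound i)) hmem ?_ hy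
  convert hmin using 2 with y
  simp only [proxObjective, lt_irrefl, if_false]
  ring

end Assumptions

theorem IsRun.mem_convexHull {K : ℕ} {x : ℕ → Fin n → Euc d} (hrun : G.IsRun Lg K x) {k : ℕ}
    (hk : k ≤ K) (i : Fin n) : x k i ∈ convexHull ℝ (G.X i) := by
  cases k with
  | zero => exact hrun.1 i
  | succ k => exact (hrun.2 k hk i).1

/-! ### Descent of the potential along the algorithm. -/

/-- The potential of the convexified game with primitives `F t` of the costs `g t`. -/
noncomputable def potential (G : CongestionGame n d) (F : Fin d → ℝ → ℝ) (y : Fin n → Euc d) : ℝ :=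
  n * ∑ t, F t (G.agg y t) + ∑ i, G.a i * G.localConv i (y i)

namespace Assumptions

variable (H : G.Assumptions m M Δ D₁ D₂ Bg Br Lg Lh)
include H

/-- The aggregate moves by `a i / n` times the action. The factor `n` in the potential cancels this
denominator in the linear term and leaves one `1 / n` in the quadratic term. -/
theorem potential_update_sub_le (hn : 0 < n) {F : Fin d → ℝ → ℝ}
    (hF : ∀ t, ∀ u ∈ Icc D₁ D₂, ∀ v ∈ Icc D₁ D₂,
      F t v - F t u ≤ G.g t u * (v - u) + Lg / 2 * (v - u) ^ 2)
    {y : Fin n → Euc d} (hy : ∀ i, y i ∈ convexHull ℝ (G.X i)) (i : Fin n) {p : Euc d}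
    (hp : p ∈ convexHull ℝ (G.X i)) :
    G.potential F (Function.update y i p) - G.potential F y ≤
      G.a i * (inner ℝ (G.gVec (G.agg y)) (p - y i) + G.localConv i p - G.localConv i (y i)) +
        G.a i ^ 2 * Lg / (2 * n) * ‖p - y i‖ ^ 2 := by
  have hn' : (0 : ℝ) < n := by exact_mod_cast hn
  have h1 : ∑ j, G.a j * G.localConv j (Function.update y i p j) -
      ∑ j, G.a j * G.localConv j (y j) = G.a i * (G.localConv i p - G.localConv i (y i)) := by
    rw [← Finset.sum_sub_distrib, Finset.sum_eq_single i]
    · simp [mul_sub]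
    · intro j _ hj
      simp [Function.update_of_ne hj]
    · simp
  have h2 : ∑ t, F t (G.agg (Function.update y i p) t) - ∑ t, F t (G.agg y t) ≤
      ∑ t, (G.g t (G.agg y t) * (G.a i / n * (p - y i) t) +
        Lg / 2 * (G.a i / n * (p - y i) t) ^ 2) := by
    rw [← Finset.sum_sub_distrib]
    refine Finset.sum_le_sum fun t _ => ?_
    have h := hF t _ (H.agg_mem y hy t) _ (H.agg_mem _ (update_mem_convexHull hy hp) t)
    rw [agg_update] at h ⊢
    simpa using h
  have h3 : inner ℝ (G.gVec (G.agg y)) (p - y i) = ∑ t, G.g t (G.agg y t) * (p - y i) t := by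
    simp [PiLp.inner_apply, gVec, mul_comm]
  have h4 : ‖p - y i‖ ^ 2 = ∑ t, ((p - y i) t) ^ 2 := by
    simp [EuclideanSpace.norm_sq_eq]
  have h5 : (n : ℝ) * ∑ t, (G.g t (G.agg y t) * (G.a i / n * (p - y i) t) +
        Lg / 2 * (G.a i / n * (p - y i) t) ^ 2) =
      G.a i * inner ℝ (G.gVec (G.agg y)) (p - y i) +
        G.a i ^ 2 * Lg / (2 * n) * ‖p - y i‖ ^ 2 := by
    rw [h3, h4, Finset.mul_sum, Finset.mul_sum, Finset.mul_sum, ← Finset.sum_add_distrib]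
    refine Finset.sum_congr rfl fun t _ => ?_
    field_simp
  have h6 := mul_le_mul_of_nonneg_left h2 hn'.le
  rw [h5] at h6
  simp only [potential]
  linarith

/-- Optimality tested at the old action gains twice the quadratic error of the potential estimate,
so one copy is left as decrease. -/
theorem potential_succ_add_le (hm : 0 < m) (hn : 0 < n) {F : Fin d → ℝ → ℝ}
    (hF : ∀ t, ∀ u ∈ Icc D₁ D₂, ∀ v ∈ Icc D₁ D₂,
      F t v - F t u ≤ G.g t u * (v - u) + Lg / 2 * (v - u) ^ 2)
    {K : ℕ} {x : ℕ → Fin n → Euc d} (hrun : G.IsRun Lg K x) {k : ℕ} (hk : k < K) :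
    m ^ 2 * Lg / (2 * n) * ∑ i, ‖x (k + 1) i - x k i‖ ^ 2 ≤
      G.potential F (x k) - G.potential F (x (k + 1)) := by
  have hn' : (0 : ℝ) < n := by exact_mod_cast hn
  -- `y l` is the profile after the first `l` players have updated; with players indexed from `0`,
  -- `y i` is exactly what player `i` sees.
  set y : ℕ → Fin n → Euc d := fun l j => if (j : ℕ) < l then x (k + 1) j else x k j with hy
  have hy0 : y 0 = x k := by ext1 j; simp [hy]
  have hyn : y n = x (k + 1) := by ext1 j; simp [hy]
  have hymem : ∀ l i, y l i ∈ convexHull ℝ (G.X i) := by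
    intro l i
    simp only [hy]
    split_ifs
    exacts [hrun.mem_convexHull hk i, hrun.mem_convexHull hk.le i]
  have hyi : ∀ i : Fin n, y i i = x k i := fun i => by simp [hy]
  have hysucc : ∀ i : Fin n, y (i + 1) = Function.update (y i) i (x (k + 1) i) := by
    intro i
    ext1 j
    by_cases h : j = i
    · subst h; simp [hy]
    · have : (j : ℕ) ≠ i := fun h' => h (Fin.ext h')
      have : (j : ℕ) < i + 1 ↔ (j : ℕ) < i := by omega
      simp only [hy, Function.update_of_ne h, this]
  have hstep : ∀ i : Fin n, G.potential F (y (i + 1)) - G.potential F (y i) ≤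
      -(m ^ 2 * Lg / (2 * n) * ‖x (k + 1) i - x k i‖ ^ 2) := by
    intro i
    have h1 := H.potential_update_sub_le hn hF (hymem i) i (hrun.mem_convexHull hk i)
    have h2 := H.prox_first_order hrun hk i (hrun.mem_convexHull hk.le i)
    have hcur : (fun j => if j < i then x (k + 1) j else x k j) = y i := rfl
    rw [hcur, inner_add_left, real_inner_smul_left, ← neg_sub (x (k + 1) i) (x k i), inner_neg_right,
      inner_neg_right, real_inner_self_eq_norm_sq] at h2
    rw [← hysucc, hyi] at h1
    have h3 : m ^ 2 * Lg / (2 * n) * ‖x (k + 1) i - x k i‖ ^ 2 ≤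
        G.a i ^ 2 * Lg / (2 * n) * ‖x (k + 1) i - x k i‖ ^ 2 := by
      gcongr
      exact (H.weight_mem i).1
    have h4 := mul_nonneg (H.weight_nonneg hm i) h2
    have h5 : G.a i * (G.a i * Lg / n * ‖x (k + 1) i - x k i‖ ^ 2) =
        2 * (G.a i ^ 2 * Lg / (2 * n) * ‖x (k + 1) i - x k i‖ ^ 2) := by
      field_simp
    linarith
  have htel := Finset.sum_range_sub (fun l => G.potential F (y l)) n
  rw [Finset.sum_range, hy0, hyn] at htel
  have := Finset.sum_le_sum fun i (_ : i ∈ Finset.univ) => hstep i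
  rw [htel, Finset.sum_neg_distrib, ← Finset.mul_sum] at this
  linarith

theorem potential_sub_le (hm : 0 < m) (hn : 0 < n) {F : Fin d → ℝ → ℝ}
    (hF : ∀ t, ∀ u ∈ Icc D₁ D₂, ∀ v ∈ Icc D₁ D₂, |F t v - F t u| ≤ Bg * |v - u|)
    {x y : Fin n → Euc d} (hx : ∀ i, x i ∈ convexHull ℝ (G.X i))
    (hy : ∀ i, y i ∈ convexHull ℝ (G.X i)) :
    G.potential F x - G.potential F y ≤ n * iterConst d M Δ Bg Br := by
  have hn' : (0 : ℝ) < n := by exact_mod_cast hn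
  have hM : 0 ≤ M := (H.weight_nonneg hm ⟨0, hn⟩).trans (H.weight_mem ⟨0, hn⟩).2
  have hagg : ‖G.agg x - G.agg y‖ ≤ M * Δ := by
    refine (H.norm_agg_sub_le hm x y).trans ?_
    gcongr
    calc 1 / (n : ℝ) * ∑ j, ‖x j - y j‖ ≤ 1 / n * ∑ _j : Fin n, Δ := by
          gcongr with j
          exact H.diam_le j _ (hx j) _ (hy j)
      _ = Δ := by simp; field_simp
  have h1 : ∑ t, F t (G.agg x t) - ∑ t, F t (G.agg y t) ≤ d * (Bg * (M * Δ)) := by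
    rw [← Finset.sum_sub_distrib]
    refine (Finset.sum_le_sum (g := fun _ => Bg * (M * Δ)) fun t _ => ?_).trans (by simp)
    have hB : 0 ≤ Bg := (abs_nonneg _).trans (H.g_bound t _ (H.agg_mem x hx t))
    refine (le_abs_self _).trans ((hF t _ (H.agg_mem y hy t) _ (H.agg_mem x hx t)).trans ?_)
    gcongr
    exact (PiLp.norm_apply_le (G.agg x - G.agg y) t).trans hagg
  have h2 : ∑ i, G.a i * G.localConv i (x i) - ∑ i, G.a i * G.localConv i (y i) ≤
      n * (M * (2 * Br)) := by
    rw [← Finset.sum_sub_distrib]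
    refine (Finset.sum_le_sum (g := fun _ => M * (2 * Br)) fun i _ => ?_).trans (by simp)
    have hx' := abs_le.1 (abs_convexification_le (H.r_bound i) (hx i))
    have hy' := abs_le.1 (abs_convexification_le (H.r_bound i) (hy i))
    have hB : 0 ≤ Br := by linarith
    rw [← mul_sub]
    exact (mul_le_mul_of_nonneg_left (by linarith) (H.weight_nonneg hm i)).trans
      (mul_le_mul_of_nonneg_right (H.weight_mem i).2 (by linarith))
  simp only [potential, iterConst]
  nlinarith [mul_le_mul_of_nonneg_left h1 hn'.le]

theorem weight_bound_nonneg (hm : 0 < m) (hn : 0 < n) : 0 ≤ M :=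
  (H.weight_nonneg hm ⟨0, hn⟩).trans (H.weight_mem ⟨0, hn⟩).2

theorem sum_sq_le (hm : 0 < m) (hLg : 0 < Lg) (hn : 0 < n) {K : ℕ} {x : ℕ → Fin n → Euc d}
    (hrun : G.IsRun Lg K x) :
    ∑ k ∈ Finset.range K, ∑ i, ‖x (k + 1) i - x k i‖ ^ 2 ≤
      2 * iterConst d M Δ Bg Br / (m ^ 2 * Lg) * (n : ℝ) ^ 2 := by
  have hn' : (0 : ℝ) < n := by exact_mod_cast hn
  have hL : (0 : ℝ) < Lg := by exact_mod_cast hLg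
  choose F hF hFB using fun t => (H.g_lipschitz t).exists_primitive
  have h1 : m ^ 2 * Lg / (2 * n) * ∑ k ∈ Finset.range K, ∑ i, ‖x (k + 1) i - x k i‖ ^ 2 ≤
      n * iterConst d M Δ Bg Br := by
    rw [Finset.mul_sum]
    refine (Finset.sum_le_sum fun k hk =>
      H.potential_succ_add_le hm hn hF hrun (Finset.mem_range.1 hk)).trans ?_
    rw [Finset.sum_range_sub' (fun k => G.potential F (x k))]
    exact H.potential_sub_le hm hn (fun t => hFB t Bg (H.g_bound t)) hrun.1
      (hrun.mem_convexHull le_rfl)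
  rw [div_mul_eq_mul_div, le_div_iff₀ (by positivity)]
  rw [div_mul_eq_mul_div, div_le_iff₀ (by positivity)] at h1
  linarith

/-- After sufficiently many iterations, some iteration moves the profile only a little. -/
theorem exists_mean_norm_sub_le (hm : 0 < m) (hLg : 0 < Lg) (hn : 0 < n) (δ : ℝ) {K : ℕ}
    (hK : 2 * iterConst d M Δ Bg Br / (m ^ 2 * Lg) * (n : ℝ) ^ (1 + 2 * δ) + 1 ≤ (K : ℝ))
    {x : ℕ → Fin n → Euc d} (hrun : G.IsRun Lg K x) :
    ∃ k < K, 1 / (n : ℝ) * ∑ i, ‖x (k + 1) i - x k i‖ ≤ (n : ℝ) ^ (-δ) := by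
  have hn' : (0 : ℝ) < n := by exact_mod_cast hn
  have hpow : (0 : ℝ) < (n : ℝ) ^ (1 - 2 * δ) := by positivity
  obtain ⟨k, hk, hle⟩ : ∃ k < K, ∑ i, ‖x (k + 1) i - x k i‖ ^ 2 ≤ (n : ℝ) ^ (1 - 2 * δ) := by
    -- Otherwise the squared steps would sum to at least `K * n ^ (1 - 2 * δ)`. The `+ 1` in the
    -- bound on `K` makes this strictly exceed the total allowed by `sum_sq_le`.
    by_contra! h
    have h1 := (Finset.sum_le_sum fun k hk => (h k (Finset.mem_range.1 hk)).le).trans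
      (H.sum_sq_le hm hLg hn hrun)
    rw [Finset.sum_const, Finset.card_range, nsmul_eq_mul] at h1
    have h2 := mul_le_mul_of_nonneg_right hK hpow.le
    have h3 : (n : ℝ) ^ (1 + 2 * δ) * (n : ℝ) ^ (1 - 2 * δ) = (n : ℝ) ^ 2 := by
      rw [← Real.rpow_add hn', ← Real.rpow_natCast]
      norm_num
    rw [add_mul, mul_assoc _ ((n : ℝ) ^ (1 + 2 * δ)), h3] at h2
    linarith
  refine ⟨k, hk, (sq_le_sq₀ (by positivity) (by positivity)).1 ?_⟩
  have hcs := sq_sum_le_card_mul_sum_sq (s := Finset.univ) (f := fun i => ‖x (k + 1) i - x k i‖)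
  rw [Finset.card_univ, Fintype.card_fin] at hcs
  have h4 : (n : ℝ) ^ (1 - 2 * δ) = n * ((n : ℝ) ^ (-δ)) ^ 2 := by
    rw [sub_eq_add_neg, Real.rpow_add hn', Real.rpow_one, ← Real.rpow_natCast,
      ← Real.rpow_mul hn'.le]
    congr 2
    push_cast
    ring
  rw [mul_pow, one_div, inv_pow, inv_mul_le_iff₀ (by positivity)]
  calc (∑ i, ‖x (k + 1) i - x k i‖) ^ 2 ≤ n * (n : ℝ) ^ (1 - 2 * δ) :=
        hcs.trans (by gcongr)
    _ = _ := by rw [h4]; ring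

/-- The gradient error has three sources: the mean movement `n ^ (-δ)`, the replacement of the own
action by `xp i`, and the proximal term. The last two cost `Δ / n` each. -/
theorem exists_isSelected (hm : 0 < m) (hLg : 0 < Lg) (hn : 0 < n) {xp : Fin n → Euc d}
    (hxp : ∀ i, xp i ∈ G.X i) (δ : ℝ) {K : ℕ}
    (hK : 2 * iterConst d M Δ Bg Br / (m ^ 2 * Lg) * (n : ℝ) ^ (1 + 2 * δ) + 1 ≤ (K : ℝ))
    {x : ℕ → Fin n → Euc d} (hrun : G.IsRun Lg K x) :
    ∃ k, 1 ≤ k ∧ k ≤ K ∧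
      G.IsSelected xp (Lg * M * Δ * ((n : ℝ) ^ (-δ) + 2 * Δ / n)) (x k) := by
  have hn' : (0 : ℝ) < n := by exact_mod_cast hn
  have hM := H.weight_bound_nonneg hm hn
  obtain ⟨k, hk, hle⟩ := H.exists_mean_norm_sub_le hm hLg hn δ hK hrun
  refine ⟨k + 1, by omega, hk, ?_⟩
  have hmem := hrun.mem_convexHull hk
  have hmem' := hrun.mem_convexHull hk.le
  have hxp' : ∀ i, xp i ∈ convexHull ℝ (G.X i) := fun i => subset_convexHull ℝ _ (hxp i)
  rw [show (Lg : ℝ) * M * Δ * ((n : ℝ) ^ (-δ) + 2 * Δ / n) =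
    Lg * M * ((n : ℝ) ^ (-δ) + 2 * Δ / n) * Δ by ring]
  refine H.isSelected_of_first_order hmem fun i =>
    ⟨_, ?_, fun y hy => H.prox_first_order hrun hk i hy⟩
  set cur : Fin n → Euc d := fun j => if j < i then x (k + 1) j else x k j with hcur
  have hcurmem : ∀ j, cur j ∈ convexHull ℝ (G.X j) := by
    intro j
    simp only [hcur]
    split_ifs
    exacts [hmem j, hmem' j]
  have hsum : 1 / (n : ℝ) * ∑ j, ‖Function.update (x (k + 1)) i (xp i) j - cur j‖ ≤
      (n : ℝ) ^ (-δ) + Δ / n := by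
    have h1 : ∀ j, ‖Function.update (x (k + 1)) i (xp i) j - cur j‖ ≤
        ‖x (k + 1) j - x k j‖ + if j = i then Δ else 0 := by
      intro j
      by_cases h : j = i
      · subst h
        simpa using (H.diam_le j _ (hxp' j) _ (hcurmem j)).trans (le_add_of_nonneg_left
          (norm_nonneg _))
      · simp only [Function.update_of_ne h, h, if_false, add_zero, hcur]
        split_ifs
        · simp
        · exact le_rfl
    have h2 := Finset.sum_le_sum fun j (_ : j ∈ Finset.univ) => h1 j
    rw [Finset.sum_add_distrib, Finset.sum_ite_eq' _ i, if_pos (Finset.mem_univ i)] at h2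
    calc _ ≤ 1 / (n : ℝ) * (∑ j, ‖x (k + 1) j - x k j‖ + Δ) := by gcongr
      _ = 1 / (n : ℝ) * ∑ j, ‖x (k + 1) j - x k j‖ + Δ / n := by ring
      _ ≤ _ := by gcongr
  have h3 := (H.norm_gVec_sub_le (H.agg_mem _ (update_mem_convexHull hmem (hxp' i)))
    (H.agg_mem _ hcurmem)).trans (mul_le_mul_of_nonneg_left ((H.norm_agg_sub_le hm _ _).trans
      (mul_le_mul_of_nonneg_left hsum hM)) Lg.2)
  have h4 : ‖(G.a i * Lg / n) • (x (k + 1) i - x k i)‖ ≤ M * Lg / n * Δ := by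
    have ha := H.weight_nonneg hm i
    rw [norm_smul, Real.norm_of_nonneg (by positivity)]
    gcongr
    exacts [(H.weight_mem i).2, H.diam_le i _ (hmem i) _ (hmem' i)]
  rw [← sub_sub]
  refine ((norm_sub_le _ _).trans (add_le_add h3 h4)).trans_eq ?_
  ring

/-! ### Return to the original game and conclusion. -/

/-- Rounding a selected profile gives an approximate equilibrium of the original game. -/
theorem isApproxPNE_cost (hm : 0 < m) (hn : 0 < n) {xp x : Fin n → Euc d} (hxp : ∀ i, xp i ∈ G.X i)
    {τ : ℝ} (hsel : G.IsSelected xp τ x) {Z : Fin n → Set (Euc d)}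
    (hZ : IsGeneratorProfile G.X (G.auxCost xp) x Z) {xs : Fin n → Euc d}
    (hxs : IsDisaggregation G.a x Z xs) :
    IsApproxPNE G.X G.cost (2 * τ + Lg * M * Δ * ((d + 2) * Δ / n) + Lh * M * Δ / n) xs := by
  have hn' : (0 : ℝ) < n := by exact_mod_cast hn
  have hM := H.weight_bound_nonneg hm hn
  have hgen : ∀ i, IsGenerator (G.X i) (fun y =>
      inner ℝ (G.gVec (G.agg (Function.update x i (xp i)))) y + G.r i y) (x i) (Z i) := fun i => by
    simpa [auxCost] using hZ i
  have hx := hsel.1.1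
  simp only [convexActions] at hx
  have hΔ : 0 ≤ Δ := (norm_nonneg _).trans (H.norm_le ⟨0, hn⟩ _ (hx _))
  have hZX : ∀ i, Z i ⊆ G.X i := by
    intro i
    obtain ⟨-, w, -, -, hwX, -, -, hZw⟩ := hgen i
    rw [hZw]
    exact range_subset_iff.2 hwX
  have hZfin : ∀ i, (Z i).Finite := by
    intro i
    obtain ⟨-, w, -, -, -, -, -, hZw⟩ := hgen i
    rw [hZw]
    exact finite_range w
  have hxZ : ∀ i, x i ∈ convexHull ℝ (Z i) := by
    intro i
    obtain ⟨α, w, hα, hα1, -, hwx, -, hZw⟩ := hgen i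
    rw [hZw, ← hwx]
    exact (convex_convexHull ℝ _).sum_mem (fun k _ => (hα k).le) hα1
      fun k _ => subset_convexHull ℝ _ (mem_range_self k)
  have hhull : ∀ i, convexHull ℝ (Z i) ⊆ convexHull ℝ (G.X i) := fun i => convexHull_mono (hZX i)
  have hXhull : ∀ i, G.X i ⊆ convexHull ℝ (G.X i) := fun i => subset_convexHull ℝ _
  have hxsX : ∀ i, xs i ∈ G.X i := fun i => hZX i (hxs.1 i)
  have hxsmem : ∀ i, xs i ∈ convexHull ℝ (G.X i) := fun i => hXhull i (hxsX i)
  refine ⟨hxsX, fun i y hy => ?_⟩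
  have hyX := hXhull i hy
  -- The aggregate of `xs` is close to that of `x`.
  have hdis : ‖∑ i, G.a i • x i - ∑ i, G.a i • xs i‖ ≤ d * (M * Δ) := by
    obtain ⟨p, hp, hpx⟩ := exists_norm_sum_sub_sum_le G.a Z hZfin x hxZ
      (mul_nonneg hM hΔ) fun i y hy z hz => by
        rw [norm_smul, Real.norm_of_nonneg (H.weight_nonneg hm i)]
        exact mul_le_mul (H.weight_mem i).2
          (H.diam_le i _ (hhull i hy) _ (hXhull i (hZX i hz))) (norm_nonneg _) hM
    rw [finrank_euclideanSpace_fin] at hpx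
    exact ((sq_le_sq₀ (norm_nonneg _) (norm_nonneg _)).1 (hxs.2 p hp)).trans hpx
  have hagg : ‖G.agg xs - G.agg x‖ ≤ d * (M * Δ) / n := by
    rw [norm_sub_rev, agg, agg, ← smul_sub, norm_smul, Real.norm_of_nonneg (by positivity),
      one_div_mul_eq_div]
    gcongr
  have hupd : ∀ u : Fin n → Euc d, (∀ j, u j ∈ convexHull ℝ (G.X j)) → ∀ p ∈ convexHull ℝ (G.X i),
      ‖G.agg u - G.agg (Function.update u i p)‖ ≤ M * Δ / n := by
    intro u hu p hp
    rw [agg_update, sub_add_cancel_left, norm_neg, norm_smul, mul_div_right_comm,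
      Real.norm_of_nonneg (div_nonneg (H.weight_nonneg hm i) hn'.le)]
    gcongr
    exacts [(H.weight_mem i).2, H.diam_le i _ hp _ (hu i)]
  set A := G.agg xs with hA
  set A' := G.agg (Function.update xs i y) with hA'
  set B := G.agg (Function.update x i (xp i)) with hB
  have hAm : ∀ t, A t ∈ Icc D₁ D₂ := H.agg_mem _ hxsmem
  have hAm' : ∀ t, A' t ∈ Icc D₁ D₂ := H.agg_mem _ (update_mem_convexHull hxsmem hyX)
  have hBm : ∀ t, B t ∈ Icc D₁ D₂ := H.agg_mem _ (update_mem_convexHull hx (hXhull i (hxp i)))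
  have hAA' : ‖A - A'‖ ≤ M * Δ / n := hupd xs hxsmem y hyX
  have hAB : ‖A - B‖ ≤ d * (M * Δ) / n + M * Δ / n :=
    (norm_sub_le_norm_sub_add_norm_sub A (G.agg x) B).trans
      (add_le_add hagg (hupd x hx _ (hXhull i (hxp i))))
  have hh : G.h i A - G.h i A' ≤ Lh * (M * Δ / n) := by
    have := (H.h_lipschitz i).dist_le_mul A hAm A' hAm'
    rw [Real.dist_eq, dist_eq_norm] at this
    exact (le_abs_self _).trans (this.trans (mul_le_mul_of_nonneg_left hAA' Lh.2))
  -- The linear costs are split as `⟨g A, xs i⟩ - ⟨g A', y⟩ = ⟨g A - g B, xs i - y⟩ + ⟨g A - g A',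
  -- y⟩ + ⟨g B, xs i - y⟩`. The first two terms contribute `d + 1` and `1` to the factor `d + 2`;
  -- the third is handled by selection.
  have hg1 : inner ℝ (G.gVec A - G.gVec B) (xs i - y) ≤
      Lg * (d * (M * Δ) / n + M * Δ / n) * Δ :=
    (real_inner_le_norm _ _).trans (mul_le_mul ((H.norm_gVec_sub_le hAm hBm).trans
      (mul_le_mul_of_nonneg_left hAB Lg.2)) (H.diam_le i _ (hxsmem i) _ hyX) (norm_nonneg _)
      (by positivity))
  have hg2 : inner ℝ (G.gVec A - G.gVec A') y ≤ Lg * (M * Δ / n) * Δ :=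
    (real_inner_le_norm _ _).trans (mul_le_mul ((H.norm_gVec_sub_le hAm hAm').trans
      (mul_le_mul_of_nonneg_left hAA' Lg.2)) (H.norm_le i _ hyX) (norm_nonneg _)
      (by positivity))
  -- Stability and the equilibrium property of `x`.
  have hs1 := hsel.2 Z hZ i (xs i) (hxs.1 i)
  have hs2 := hsel.1.2 i y hyX
  rw [H.convexCost_update xp x i (hxsmem i)] at hs1
  rw [H.convexCost_update xp x i hyX] at hs2
  have hr1 : G.localConv i (xs i) = G.r i (xs i) :=
    ((hgen i).eq_and_exists_extrapolation (H.r_bound i) (hxs.1 i)).1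
  have hr2 : G.localConv i y ≤ G.r i y := convexification_le_self (H.r_bound i) hy
  rw [hr1, ← hB] at hs1
  rw [← hB] at hs2
  simp only [cost, Function.update_self, ← hA, ← hA']
  simp only [inner_sub_left, inner_sub_right] at hg1 hg2
  have hfin : Lg * (d * (M * Δ) / n + M * Δ / n) * Δ + Lg * (M * Δ / n) * Δ =
      Lg * M * Δ * ((d + 2) * Δ / n) := by ring
  have hfin' : Lh * (M * Δ / n) = Lh * M * Δ / n := by ring
  linarith

end Assumptions

end CongestionGame

theorem mainTheorem3 (d : ℕ) (m M Δ D₁ D₂ Bg Br : ℝ) (Lg Lh : ℝ≥0) (hm : 0 < m) (hLg : 0 < Lg) :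
    (∀ δ : ℝ, 0 < δ → ∀ n : ℕ, 0 < n → ∀ G : CongestionGame n d,
      G.Assumptions m M Δ D₁ D₂ Bg Br Lg Lh →
      ∀ xp : Fin n → Euc d, (∀ i, xp i ∈ G.X i) →
      ∀ K : ℕ, 2 * iterConst d M Δ Bg Br / (m ^ 2 * Lg) * (n : ℝ) ^ (1 + 2 * δ) + 1 ≤ (K : ℝ) →
      ∀ x : ℕ → Fin n → Euc d, G.IsRun Lg K x →
        (∃ k, 1 ≤ k ∧ k ≤ K ∧
          G.IsSelected xp (Lg * M * Δ * ((n : ℝ) ^ (-δ) + 2 * Δ / n)) (x k)) ∧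
        ∀ k ≤ K, G.IsSelected xp (Lg * M * Δ * ((n : ℝ) ^ (-δ) + 2 * Δ / n)) (x k) →
          ∀ Z : Fin n → Set (Euc d), IsGeneratorProfile G.X (G.auxCost xp) (x k) Z →
          ∀ xs : Fin n → Euc d, IsDisaggregation G.a (x k) Z xs →
            IsApproxPNE G.X G.cost
              (2 * Lg * M * Δ * ((n : ℝ) ^ (-δ) + (d + 4) * Δ / n) + Lh * M * Δ / n) xs) ∧
    (∃ A c : ℝ, ∀ n : ℕ, 0 < n → ∀ G : CongestionGame n d,
      G.Assumptions m M Δ D₁ D₂ Bg Br Lg Lh →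
      ∀ xp : Fin n → Euc d, (∀ i, xp i ∈ G.X i) →
      ∀ K : ℕ, A * (n : ℝ) ^ 3 ≤ (K : ℝ) →
      ∀ x : ℕ → Fin n → Euc d, G.IsRun Lg K x →
        (∃ k, 1 ≤ k ∧ k ≤ K ∧
          G.IsSelected xp (Lg * M * Δ * ((n : ℝ)⁻¹ + 2 * Δ / n)) (x k)) ∧
        ∀ k ≤ K, G.IsSelected xp (Lg * M * Δ * ((n : ℝ)⁻¹ + 2 * Δ / n)) (x k) →
          ∀ Z : Fin n → Set (Euc d), IsGeneratorProfile G.X (G.auxCost xp) (x k) Z →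
          ∀ xs : Fin n → Euc d, IsDisaggregation G.a (x k) Z xs →
            IsApproxPNE G.X G.cost (c / n) xs) := by
  have mono : ∀ {n : ℕ} {G : CongestionGame n d} {ε ε' : ℝ} {x : Fin n → Euc d},
      IsApproxPNE G.X G.cost ε x → ε ≤ ε' → IsApproxPNE G.X G.cost ε' x :=
    fun h hε => ⟨h.1, fun i y hy => (h.2 i y hy).trans (by gcongr)⟩
  have main : ∀ δ : ℝ, ∀ n : ℕ, 0 < n → ∀ G : CongestionGame n d,
      G.Assumptions m M Δ D₁ D₂ Bg Br Lg Lh →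
      ∀ xp : Fin n → Euc d, (∀ i, xp i ∈ G.X i) →
      ∀ x : Fin n → Euc d, G.IsSelected xp (Lg * M * Δ * ((n : ℝ) ^ (-δ) + 2 * Δ / n)) x →
          ∀ Z : Fin n → Set (Euc d), IsGeneratorProfile G.X (G.auxCost xp) x Z →
          ∀ xs : Fin n → Euc d, IsDisaggregation G.a x Z xs →
            IsApproxPNE G.X G.cost
              (2 * Lg * M * Δ * ((n : ℝ) ^ (-δ) + (d + 4) * Δ / n) + Lh * M * Δ / n) xs := by
    intro δ n hn G H xp hxp x hsel Z hZ xs hxs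
    refine mono (H.isApproxPNE_cost hm hn hxp hsel hZ hxs) ?_
    have hM := H.weight_bound_nonneg hm hn
    have hΔ : 0 ≤ Δ := (norm_nonneg _).trans
      (H.norm_le ⟨0, hn⟩ _ (subset_convexHull ℝ _ (hxp ⟨0, hn⟩)))
    have h : 0 ≤ Lg * M * Δ * ((d + 2) * Δ / n) := by positivity
    have h' : 2 * Lg * M * Δ * ((n : ℝ) ^ (-δ) + (d + 4) * Δ / n) =
      2 * (Lg * M * Δ * ((n : ℝ) ^ (-δ) + 2 * Δ / n)) + 2 * (Lg * M * Δ * ((d + 2) * Δ / n)) := by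
      ring
    linarith
  refine ⟨fun δ _ n hn G H xp hxp K hK x hrun => ⟨H.exists_isSelected hm hLg hn hxp δ hK hrun,
    fun k _ hsel => main δ n hn G H xp hxp (x k) hsel⟩,
    -- The extra `1` absorbs the `+ 1` in the bound on `K`, because `1 ≤ n ^ 3`.
    2 * iterConst d M Δ Bg Br / (m ^ 2 * Lg) + 1,
    2 * Lg * M * Δ * (1 + (d + 4) * Δ) + Lh * M * Δ, fun n hn G H xp hxp K hK x hrun => ?_⟩
  have hn1 : (1 : ℝ) ≤ n := by exact_mod_cast hn
  rw [← Real.rpow_neg_one]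
  refine ⟨H.exists_isSelected hm hLg hn hxp 1 ?_ hrun, fun k _ hsel Z hZ xs hxs =>
    mono (main 1 n hn G H xp hxp (x k) hsel Z hZ xs hxs) (le_of_eq ?_)⟩
  · have h3 : (n : ℝ) ^ (1 + 2 * (1 : ℝ)) = (n : ℝ) ^ 3 := by
      rw [← Real.rpow_natCast]; norm_num
    have h1 : (1 : ℝ) ≤ (n : ℝ) ^ 3 := one_le_pow₀ hn1
    rw [h3]
    linarith
  · rw [Real.rpow_neg_one]
    ring
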